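/- **Setting.** Let $G=(V,E)$ be a finite connected simple graph that is claw-free (no induced $K_{1,3}$) and even-hole-free (no induced cycle of even length $\ge 4$). Let $K_s\subseteq V$ be a simplicial clique: $K_s$ is a clique, and the extended graph $G_\chi$, obtained from $G$ by adding one new vertex $\chi$ adjacent to exactly the vertices of $K_s$, is again claw-free. Let $b_j\in\mathbb R\setminus\{0\}$ $(j\in V)$ be couplings. The graph Clifford algebra of $G_\chi$ is the unital associative $\mathbb C$-algebra generated by elements $h_j$ $(j\in V)$ and $\chi$ (the edge operator), all with square $1$, where generators at adjacent vertices of $G_\chi$ anticommute and generators at non-adjacent vertices commute. The operators below are taken in this algebra, or in any realization of it, i.e. as images under a homomorphism of unital $\mathbb C$-algebras to an arbitrary $\mathbb C$-algebra. Put $$\mathtt H_j=b_jh_j,\qquad H_G=\sum_{j\in V}\mathtt H_j,\qquad \phi_0=\chi,\quad \phi_{j+1}=\tfrac12[H_G,\phi_j],\qquad \Phi_G(u)=\sum_{j\ge0}u^j\phi_j ,$$ the last being a formal power series in $u$. For $U\subseteq V$ let $$P_{G[U]}(x)=\sum_{S\subseteq U\ \text{independent}}(-x)^{|S|}\prod_{j\in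 S}b_j^2 ,\qquad P_G=P_{G[V]} .$$ An induced path $\mathcal L=\chi\text{-}\ell_1\text{-}\cdots\text{-}\ell_n$ $(n\ge0)$ of $G_\chi$ rooted at $\chi$ is a sequence of $|\mathcal L|=n+1$ distinct vertices of $G_\chi$ starting with $\chi$, in which two vertices are adjacent if and only if they are consecutive. Its path product is $\mathtt H[\mathcal L]=\chi\,\mathtt H_{\ell_1}\cdots\mathtt H_{\ell_n}$, and $P_{G\setminus\Gamma[\mathcal L]}$ is the polynomial $P_{G[U]}$ for the set $U$ of vertices of $G$ that neither lie on $\mathcal L$ nor are adjacent in $G_\chi$ to a vertex of $\mathcal L$. Define $$\Xi_G(u)=\sum_{\mathcal L}(-u)^{|\mathcal L|-1}\,P_{G\setminus\Gamma[\mathcal L]}(u^2)\,\mathtt H[\mathcal L],$$ where the sum runs over all induced paths of $G_\chi$ rooted at $\chi$. **Theorem.** As formal power series in $u$, $$\Phi_G(u)=\frac{\Xi_G(u)}{P_G(u^2)}=\sum_{\mathcal L}(-u)^{|\mathcal L|-1}\,\frac{P_{G\setminus\Gamma[\mathcal L]}(u^2)}{P_G(u^2)}\,\mathtt H[\mathcal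 L],$$ where $P_G(u^2)$, having constant term $1$, is invertible as a formal power series. -/

import Mathlib

noncomputable section

namespace FreeFermion

universe u v

/-- A graph is claw-free if it has no induced `K_{1,3}`. -/
def ClawFree {W : Type u} (G : SimpleGraph W) : Prop :=
  ¬ (completeBipartiteGraph (Fin 1) (Fin 3)).IsIndContained G

/-- A graph is even-hole-free if it has no induced cycle of even length at least four. -/
def EvenHoleFree {W : Type u} (G : SimpleGraph W) : Prop :=
  ∀ n : ℕ, 4 ≤ n → Even n → ¬ (SimpleGraph.cycleGraph n).IsIndContained G

/-- Even-hole-free and claw-free graphs. -/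
structure IsECF {W : Type u} (G : SimpleGraph W) : Prop where
  evenHoleFree : EvenHoleFree G
  clawFree : ClawFree G

/-- The extended graph `G_χ`: one new vertex `none` (standing for `χ`) is added to `G` and joined
to all vertices of `K` and to no other vertex. -/
def extendedGraph {V : Type u} (G : SimpleGraph V) (K : Set V) : SimpleGraph (Option V) where
  Adj
    | none, none => False
    | none, some j => j ∈ K
    | some i, none => i ∈ K
    | some i, some j => G.Adj i j
  symm := ⟨by
    rintro (_ | i) (_ | j) h
    · exact h
    · exact h
    · exact h
    · exact G.adj_symm h⟩
  loopless := ⟨by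
    rintro (_ | i) h
    · exact h
    · exact G.irrefl h⟩

/-- A clique `K` of a claw-free graph `G` is simplicial if the extended graph is claw-free. -/
structure IsSimplicialClique {V : Type u} (G : SimpleGraph V) (K : Set V) : Prop where
  isClique : G.IsClique K
  clawFree : ClawFree G
  clawFree_extended : ClawFree (extendedGraph G K)

/-- The relations of the graph Clifford algebra: generators square to one, generators at adjacent
vertices anticommute, generators at non-adjacent vertices commute. -/
inductive CliffordRel {W : Type u} (G : SimpleGraph W) :
    FreeAlgebra ℂ W → FreeAlgebra ℂ W → Prop
  | sq (i : W) : CliffordRel G (FreeAlgebra.ι ℂ i * FreeAlgebra.ι ℂ i) 1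
  | anticomm (i j : W) (hij : G.Adj i j) :
      CliffordRel G (FreeAlgebra.ι ℂ i * FreeAlgebra.ι ℂ j)
        (-(FreeAlgebra.ι ℂ j * FreeAlgebra.ι ℂ i))
  | comm (i j : W) (hij : ¬ G.Adj i j) :
      CliffordRel G (FreeAlgebra.ι ℂ i * FreeAlgebra.ι ℂ j)
        (FreeAlgebra.ι ℂ j * FreeAlgebra.ι ℂ i)

/-- The (complex) graph Clifford algebra of a graph. -/
abbrev GraphClifford {W : Type u} (G : SimpleGraph W) : Type u := RingQuot (CliffordRel G)

/-- The generator `h_i` of the graph Clifford algebra. -/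
def cliffordGen {W : Type u} (G : SimpleGraph W) (i : W) : GraphClifford G :=
  RingQuot.mkAlgHom ℂ (CliffordRel G) (FreeAlgebra.ι ℂ i)

section Operators

variable {V : Type u} {A : Type v} [Ring A] [Algebra ℂ A]

/-- The coupling-dependent generators in a realization `ρ` of the graph Clifford algebra of the
extended graph: the edge operator `χ` at the new vertex, and `H_j = b_j h_j` at `j`. -/
def vertexOp (G : SimpleGraph V) (K : Set V) (b : V → ℝ)
    (ρ : GraphClifford (extendedGraph G K) →ₐ[ℂ] A) : Option V → A
  | none => ρ (cliffordGen (extendedGraph G K) none)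
  | some j => (b j : ℂ) • ρ (cliffordGen (extendedGraph G K) (some j))

/-- The Hamiltonian `H_G = ∑ j, H_j`. -/
def hamiltonian [Fintype V] (G : SimpleGraph V) (K : Set V) (b : V → ℝ)
    (ρ : GraphClifford (extendedGraph G K) →ₐ[ℂ] A) : A :=
  ∑ j : V, vertexOp G K b ρ (some j)

/-- The sequence `φ 0 = χ`, `φ (j + 1) = (1 / 2) [H, φ j]`. -/
def krylov (H χ : A) : ℕ → A
  | 0 => χ
  | j + 1 => (1 / 2 : ℂ) • (H * krylov H χ j - krylov H χ j * H)

/-- The generating function `Φ_G(u) = ∑ j, u ^ j φ_j` of the Krylov basis, as a formal power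
series in `u` with coefficients in the algebra of operators. -/
def krylovSeries [Fintype V] (G : SimpleGraph V) (K : Set V) (b : V → ℝ)
    (ρ : GraphClifford (extendedGraph G K) →ₐ[ℂ] A) : PowerSeries A :=
  PowerSeries.mk (krylov (hamiltonian G K b ρ) (vertexOp G K b ρ none))

/-- The path product of a sequence of vertices, from left to right. -/
def pathProd (G : SimpleGraph V) (K : Set V) (b : V → ℝ)
    (ρ : GraphClifford (extendedGraph G K) →ₐ[ℂ] A) (L : List (Option V)) : A :=
  (L.map (vertexOp G K b ρ)).prod

end Operators

section IndependencePolynomial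

variable {V : Type u}

open Classical in
/-- The weighted independence polynomial `∑ S, (-x) ^ |S| ∏ j ∈ S, b_j ^ 2` of the subgraph of `G`
induced on `U`; the sum is over the independent sets `S ⊆ U`. -/
def indepPoly (G : SimpleGraph V) (b : V → ℝ) (U : Finset V) : Polynomial ℂ :=
  ∑ S ∈ U.powerset.filter (fun S : Finset V => G.IsIndepSet (S : Set V)),
    (-Polynomial.X) ^ S.card * ∏ j ∈ S, Polynomial.C ((b j : ℂ) ^ 2)

/-- The polynomial `P(u ^ 2)` in `u`, for `P` the independence polynomial of the subgraph of `G`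
induced on `U`. -/
def indepPolySq (G : SimpleGraph V) (b : V → ℝ) (U : Finset V) : Polynomial ℂ :=
  (indepPoly G b U).comp (Polynomial.X ^ 2)

/-- `P(u ^ 2)` has constant term one, so it is invertible as a formal power series. -/
theorem constantCoeff_indepPolySq (G : SimpleGraph V) (b : V → ℝ) (U : Finset V) :
    PowerSeries.constantCoeff (indepPolySq G b U : PowerSeries ℂ) = 1 := by
  classical
  have h : (indepPolySq G b U).eval 0 = 1 := by
    simp only [indepPolySq, indepPoly, Polynomial.eval_comp, Polynomial.eval_finsetSum,
      Polynomial.eval_mul, Polynomial.eval_pow, Polynomial.eval_neg, Polynomial.eval_X,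
      Polynomial.eval_prod, Polynomial.eval_C]
    rw [Finset.sum_eq_single ∅]
    · simp
    · intro S _ hS
      have : S.card ≠ 0 := by simpa using hS
      simp [this]
    · intro hne
      exact absurd (by simp) hne
  rw [← Polynomial.coeff_zero_eq_eval_zero] at h
  simpa using h

end IndependencePolynomial

/-- A sequence of distinct vertices forms an induced path if it is nonempty and two of its members
are adjacent exactly when they are consecutive. -/
structure IsInducedPath {W : Type u} (G : SimpleGraph W) (L : List W) : Prop where
  ne_nil : L ≠ []
  nodup : L.Nodup
  adj_iff : ∀ i j : Fin L.length,
    G.Adj (L.get i) (L.get j) ↔ (i.val + 1 = j.val ∨ j.val + 1 = i.val)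

open Classical in
/-- The finite set of induced paths rooted at `w`, i.e. whose first vertex is `w`. -/
def rootedPaths {W : Type u} [Fintype W] (G : SimpleGraph W) (w : W) : Finset (List W) :=
  ((Finset.univ : Finset {L : List W // L.Nodup}).map (Function.Embedding.subtype _)).filter
    (fun L => IsInducedPath G L ∧ L.head? = some w)

theorem mem_rootedPaths {W : Type u} [Fintype W] (G : SimpleGraph W) (w : W) (L : List W) :
    L ∈ rootedPaths G w ↔ IsInducedPath G L ∧ L.head? = some w := by
  classical
  simp only [rootedPaths, Finset.mem_filter, Finset.mem_map, Finset.mem_univ, true_and,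
    Function.Embedding.subtype_apply, Subtype.exists, exists_prop, exists_eq_right]
  exact ⟨fun h => h.2, fun h => ⟨h.1.nodup, h⟩⟩

/-- The closed neighbourhood of a sequence of vertices. -/
def closedNbhd {W : Type u} (G : SimpleGraph W) (L : List W) : Set W :=
  {w | ∃ x ∈ L, w = x ∨ G.Adj x w}

open Classical in
/-- The vertices of `G` outside the closed neighbourhood in `G_χ` of a path in `G_χ`; they induce
the residual graph of the path. -/
def residual {V : Type u} [Fintype V] (G : SimpleGraph V) (K : Set V) (L : List (Option V)) :
    Finset V :=
  {j : V | some j ∉ closedNbhd (extendedGraph G K) L}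

/-- The generalized path-product operator
`Ξ_G(u) = ∑ L, (-u) ^ (|L| - 1) P_{G \ Γ[L]}(u ^ 2) H[L]`, a polynomial in `u` with coefficients in
the algebra of operators; the sum is over the induced paths of `G_χ` rooted at `χ`. -/
def pathProductOperator {V : Type u} {A : Type v} [Ring A] [Algebra ℂ A] [Fintype V]
    (G : SimpleGraph V) (K : Set V) (b : V → ℝ)
    (ρ : GraphClifford (extendedGraph G K) →ₐ[ℂ] A) : Polynomial A :=
  ∑ L ∈ rootedPaths (extendedGraph G K) none,
    (-Polynomial.X) ^ (L.length - 1) *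
      (indepPolySq G b (residual G K L)).map (algebraMap ℂ A) *
      Polynomial.C (pathProd G K b ρ L)

end FreeFermion

end

namespace FreeFermion

/-! ### Induced paths as lists, and the rerouting relation. -/

section Combinatorics

universe u

variable {W : Type u}

/-! The Krylov series is the unique solution of `Φ = χ + (u/2)[H, Φ]`, so it suffices that `Ξ /
P_G(u²)` solves this equation.

Commuting `H_j` with a path product gives `2 H_j H[L]` or `0`, according to the parity of the number
of neighbours of `j` on `L`. In the odd case claw-freeness leaves three possibilities
(`IndPath.classify`): `j` is the endpoint and the path shortens, `j` extends the path, or `j` can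
replace a vertex `m` of the path. In the last case the new path, paired with `m`, has the same
length and, by claw-freeness, the same closed neighbourhood. The two operators are opposite, since
an even hole would be the only obstruction (`Reroute.prod_add_prod`), so these terms cancel in pairs
(`sum_reroutable_eq_zero`).

The extending and shortening terms match the two terms in the recursion of the residual polynomials
(`indepPolySq_residual`), obtained by expanding along the clique of possible extensions. -/

theorem ClawFree.adj_of_center {G : SimpleGraph W} (hG : ClawFree G) {c x y z : W}
    (hx : G.Adj c x) (hy : G.Adj c y) (hz : G.Adj c z) (hxy : x ≠ y) (hxz : x ≠ z) (hyz : y ≠ z)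
    (nxy : ¬ G.Adj x y) (nxz : ¬ G.Adj x z) : G.Adj y z := by
  by_contra nyz
  refine hG ⟨⟨⟨Sum.elim (fun _ => c) ![x, y, z], ?_⟩, ?_⟩⟩
  · have := hx.ne; have := hy.ne; have := hz.ne
    rintro (i | i) (j | j) h <;> fin_cases i <;> fin_cases j <;> simp_all
  · have := hx.symm; have := hy.symm; have := hz.symm
    have nyx := fun h : G.Adj y x => nxy h.symm
    have nzx := fun h : G.Adj z x => nxz h.symm
    have nzy := fun h : G.Adj z y => nyz h.symm
    rintro (i | i) (j | j) <;> fin_cases i <;> fin_cases j <;> first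
      | exact iff_of_true ‹_› (by simp)
      | exact iff_of_false ‹_› (by simp)
      | exact iff_of_false (G.irrefl) (by simp)

/-- The vertices of the list are distinct, and adjacent exactly when consecutive. -/
def IndPath (G : SimpleGraph W) : List W → Prop
  | [] => True
  | x :: l => (∀ y ∈ l, x ≠ y ∧ (G.Adj x y ↔ l.head? = some y)) ∧ IndPath G l

theorem indPath_iff {G : SimpleGraph W} {L : List W} :
    IndPath G L ↔ L.Nodup ∧ ∀ i j : Fin L.length,
      (G.Adj (L.get i) (L.get j) ↔ (i.val + 1 = j.val ∨ j.val + 1 = i.val)) := by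
  induction L with
  | nil => simp [IndPath]
  | cons x l ih =>
    have hh : ∀ j : Fin l.length, l.Nodup → (l.head? = some (l.get j) ↔ j.val = 0) := by
      intro j hn
      rw [List.head?_eq_getElem?, List.getElem?_eq_getElem (j.pos), Option.some_inj]
      simp only [List.get_eq_getElem]
      rw [hn.getElem_inj_iff]
      exact eq_comm
    constructor
    · rintro ⟨h1, h2⟩
      obtain ⟨hn, h3⟩ := ih.1 h2
      refine ⟨List.nodup_cons.2 ⟨fun h => (h1 x h).1 rfl, hn⟩, ?_⟩
      intro i j
      refine Fin.cases ?_ (fun i => ?_) i <;> refine Fin.cases ?_ (fun j => ?_) j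
      · simp
      · have := (h1 (l.get j) (List.get_mem _ _)).2
        rw [hh j hn] at this
        simpa using this
      · have := (h1 (l.get i) (List.get_mem _ _)).2
        rw [hh i hn] at this
        simpa [SimpleGraph.adj_comm] using this
      · simpa using h3 i j
    · rintro ⟨hn, h3⟩
      rw [List.nodup_cons] at hn
      refine ⟨fun y hy => ⟨fun h => hn.1 (h ▸ hy), ?_⟩, ih.2 ⟨hn.2, fun i j => ?_⟩⟩
      · obtain ⟨j, rfl⟩ := List.get_of_mem hy
        rw [hh j hn.2]
        simpa using h3 0 j.succ
      · simpa using h3 i.succ j.succ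

theorem isInducedPath_iff {G : SimpleGraph W} {L : List W} :
    IsInducedPath G L ↔ L ≠ [] ∧ IndPath G L := by
  rw [indPath_iff]
  exact ⟨fun h => ⟨h.1, h.2, h.3⟩, fun h => ⟨h.1, h.2.1, h.2.2⟩⟩

theorem IndPath.nodup {G : SimpleGraph W} {L : List W} (h : IndPath G L) : L.Nodup :=
  (indPath_iff.1 h).1

theorem indPath_append {G : SimpleGraph W} {l₁ l₂ : List W} :
    IndPath G (l₁ ++ l₂) ↔ IndPath G l₁ ∧ IndPath G l₂ ∧
      ∀ x ∈ l₁, ∀ y ∈ l₂, x ≠ y ∧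
        (G.Adj x y ↔ l₁.getLast? = some x ∧ l₂.head? = some y) := by
  induction l₁ with
  | nil => simp [IndPath]
  | cons x l ih =>
    rw [List.cons_append, IndPath, IndPath, ih]
    rcases l with _ | ⟨z, l⟩
    · simp [IndPath]
      tauto
    · have key : ∀ w, (x :: z :: l).getLast? = some w ↔ (z :: l).getLast? = some w := by simp
      simp only [key, List.mem_cons, List.mem_append, List.cons_append, List.head?_cons,
        Option.some.injEq]
      constructor
      · rintro ⟨h1, ⟨h2, h3⟩, h4, h5⟩
        refine ⟨⟨fun y hy => h1 y (by tauto), h2, h3⟩, h4, ?_⟩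
        rintro w (rfl | hw) y hy
        · have hwl : ¬ (z :: l).getLast? = some w := fun h =>
            (h1 w (by have := List.mem_of_getLast? h; simp at this; tauto)).1 rfl
          have h6 := h1 y (by tauto)
          have h7 := h5 z (by simp) y hy
          refine ⟨h6.1, ?_⟩
          rw [h6.2]
          tauto
        · exact h5 w hw y hy
      · rintro ⟨⟨h1, h2, h3⟩, h4, h5⟩
        refine ⟨?_, ⟨h2, h3⟩, h4, fun w hw => h5 w (Or.inr hw)⟩
        rintro y (hy | hy | hy)
        · exact h1 y (Or.inl hy)
        · exact h1 y (Or.inr hy)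
        · have hwl : ¬ (z :: l).getLast? = some x := fun h =>
            (h1 x (by have := List.mem_of_getLast? h; simpa using this)).1 rfl
          have h6 := h5 x (Or.inl rfl) y hy
          have h7 := h5 z (by simp) y hy
          tauto

theorem indPath_reverse {G : SimpleGraph W} {l : List W} :
    IndPath G l.reverse ↔ IndPath G l := by
  induction l with
  | nil => rfl
  | cons x l ih =>
    rw [List.reverse_cons, indPath_append, ih, IndPath]
    simp [IndPath, SimpleGraph.adj_comm, eq_comm]
    tauto

theorem indPath_concat {G : SimpleGraph W} {l : List W} {x : W} :
    IndPath G (l ++ [x]) ↔ IndPath G l ∧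
      ∀ y ∈ l, y ≠ x ∧ (G.Adj y x ↔ l.getLast? = some y) := by
  simp [indPath_append, IndPath]

open Classical in
/-- The number of neighbours of `x` in the list. -/
noncomputable def nbrCount (G : SimpleGraph W) (x : W) (l : List W) : ℕ := l.countP (fun y => G.Adj x y)

theorem nbrCount_append (G : SimpleGraph W) (x : W) (l₁ l₂ : List W) :
    nbrCount G x (l₁ ++ l₂) = nbrCount G x l₁ + nbrCount G x l₂ := List.countP_append

theorem nbrCount_nil (G : SimpleGraph W) (x : W) : nbrCount G x [] = 0 := rfl

open Classical in
theorem nbrCount_cons (G : SimpleGraph W) (x y : W) (l : List W) :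
    nbrCount G x (y :: l) = nbrCount G x l + if G.Adj x y then 1 else 0 := by
  simp [nbrCount, List.countP_cons]

theorem nbrCount_eq_zero {G : SimpleGraph W} {x : W} {l : List W} (h : ∀ y ∈ l, ¬ G.Adj x y) :
    nbrCount G x l = 0 := by
  simpa [nbrCount, List.countP_eq_zero] using h

theorem nbrCount_reverse (G : SimpleGraph W) (x : W) (l : List W) :
    nbrCount G x l.reverse = nbrCount G x l := List.countP_reverse

theorem IndPath.nbrCount_head {G : SimpleGraph W} {x : W} {l : List W} (h : IndPath G (x :: l))
    (hl : l ≠ []) : nbrCount G x l = 1 := by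
  obtain ⟨y, l, rfl⟩ := List.exists_cons_of_ne_nil hl
  have hn := (List.nodup_cons.1 h.2.nodup).1
  rw [nbrCount_cons, nbrCount_eq_zero, if_pos ((h.1 y (by simp)).2.2 rfl)]
  intro z hz hxz
  have := (h.1 z (by simp [hz])).2.1 hxz
  simp at this
  exact hn (this ▸ hz)

theorem IndPath.nbrCount_last {G : SimpleGraph W} {x : W} {l : List W} (h : IndPath G (l ++ [x]))
    (hl : l ≠ []) : nbrCount G x l = 1 := by
  rw [← nbrCount_reverse]
  refine IndPath.nbrCount_head ?_ (by simpa)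
  rw [← indPath_reverse]
  simpa

theorem exists_first_nbr {G : SimpleGraph W} {x : W} {l : List W} (h : nbrCount G x l ≠ 0) :
    ∃ pre a rest, l = pre ++ a :: rest ∧ (∀ y ∈ pre, ¬ G.Adj x y) ∧ G.Adj x a := by
  induction l with
  | nil => simp [nbrCount_nil] at h
  | cons y l ih =>
    by_cases hy : G.Adj x y
    · exact ⟨[], y, l, rfl, by simp, hy⟩
    · rw [nbrCount_cons, if_neg hy] at h
      obtain ⟨pre, a, rest, rfl, h1, h2⟩ := ih h
      exact ⟨y :: pre, a, rest, rfl, by simpa [hy] using h1, h2⟩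

/-- Needed to make rerouting canonical: the vertex `x` alone dictates where the path is cut. -/
theorem first_nbr_unique {G : SimpleGraph W} {x : W} {pre pre' rest rest' : List W} {a a' : W}
    (h : pre ++ a :: rest = pre' ++ a' :: rest') (h1 : ∀ y ∈ pre, ¬ G.Adj x y) (h2 : G.Adj x a)
    (h1' : ∀ y ∈ pre', ¬ G.Adj x y) (h2' : G.Adj x a') : pre = pre' ∧ a = a' ∧ rest = rest' := by
  induction pre generalizing pre' with
  | nil =>
    rcases pre' with _ | ⟨y, pre'⟩
    · simpa using h
    · simp at h
      simp [← h.1] at h1'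
      exact absurd h2 h1'.1
  | cons z pre ih =>
    rcases pre' with _ | ⟨y, pre'⟩
    · simp at h
      simp [h.1] at h1
      exact absurd h2' h1.1
    · simp only [List.cons_append, List.cons.injEq] at h
      have := ih h.2 (fun w hw => h1 w (by simp [hw])) (fun w hw => h1' w (by simp [hw]))
      simpa [h.1] using this

/-- Two pairs of a path and a vertex whose vertex sets agree: the path is rerouted through the
vertex, which replaces a vertex of the path, and the rest of the path is possibly reversed. -/
def Reroute (G : SimpleGraph W) (p q : List W × W) : Prop :=
  ∃ pre a t t', p.1 = pre ++ a :: q.2 :: t ∧ q.1 = pre ++ a :: p.2 :: t' ∧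
    IndPath G p.1 ∧ IndPath G q.1 ∧ G.Adj p.2 q.2 ∧ t ≠ [] ∧ (t' = t ∨ t' = t.reverse)

theorem Reroute.symm {G : SimpleGraph W} {p q : List W × W} (h : Reroute G p q) :
    Reroute G q p := by
  obtain ⟨pre, a, t, t', h1, h2, h3, h4, h5, h6, h7⟩ := h
  refine ⟨pre, a, t', t, h2, h1, h4, h3, h5.symm, ?_, ?_⟩
  · rcases h7 with rfl | rfl <;> simpa
  · rcases h7 with rfl | rfl <;> simp

theorem IndPath.append_left {G : SimpleGraph W} {l₁ l₂ : List W} (h : IndPath G (l₁ ++ l₂)) :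
    IndPath G l₁ := (indPath_append.1 h).1

theorem IndPath.append_right {G : SimpleGraph W} {l₁ l₂ : List W} (h : IndPath G (l₁ ++ l₂)) :
    IndPath G l₂ := (indPath_append.1 h).2.1

theorem IndPath.adj_mid {G : SimpleGraph W} {pre t : List W} {a b : W}
    (h : IndPath G (pre ++ a :: b :: t)) : G.Adj a b :=
  (h.append_right.1 b (by simp)).2.2 rfl

theorem IndPath.not_adj_pre {G : SimpleGraph W} {pre t : List W} {a b : W}
    (h : IndPath G (pre ++ a :: b :: t)) : ∀ y ∈ pre, ¬ G.Adj b y := by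
  intro y hy hby
  have h1 := (indPath_append.1 h).2.2 y hy b (by simp)
  have h2 := h1.2.1 hby.symm
  have h3 := (h.append_right.1 b (by simp)).1
  simp at h2
  exact h3 h2.2

/-- The cut is at the first neighbour of `j`, which fixes `pre`, `a` and `m`. If both a tail and its
reverse were admissible, the only neighbour of `j` in it would be both first and last, so the tail
is a single vertex. -/
theorem Reroute.unique {G : SimpleGraph W} {p q q' : List W × W} (h : Reroute G p q)
    (h' : Reroute G p q') : q = q' := by
  obtain ⟨l, j⟩ := p
  obtain ⟨l₁, m⟩ := q
  obtain ⟨l₂, m'⟩ := q'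
  obtain ⟨pre, a, t, t₁, h1, h2, h3, h4, h5, h6, h7⟩ := h
  obtain ⟨pre', a', t', t₂, h1', h2', h3', h4', h5', h6', h7'⟩ := h'
  simp only at h1 h2 h3 h4 h5 h1' h2' h3' h4' h5'
  subst h1 h2 h2'
  obtain ⟨rfl, rfl, h9⟩ := first_nbr_unique h1' h4.not_adj_pre h4.adj_mid.symm h4'.not_adj_pre
    h4'.adj_mid.symm
  simp only [List.cons.injEq] at h9
  obtain ⟨rfl, rfl⟩ := h9
  have key : ∀ s s' : List W, s' = s.reverse → s ≠ [] → IndPath G (j :: s) → IndPath G (j :: s') →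
      s = s' := by
    rintro s _ rfl hs i1 i2
    obtain ⟨y, s, rfl⟩ := List.exists_cons_of_ne_nil hs
    have e := (i2.1 y (by simp)).2.1 ((i1.1 y (by simp)).2.2 rfl)
    simp only [List.reverse_cons] at e
    rcases List.eq_nil_or_concat s with rfl | ⟨s', z, rfl⟩
    · rfl
    · simp at e
      have := i1.2.nodup
      simp [e] at this
  have i1 : IndPath G (j :: t₁) := h4.append_right.2
  have i2 : IndPath G (j :: t₂) := h4'.append_right.2
  have : t₁ = t₂ := by
    rcases h7 with rfl | rfl <;> rcases h7' with rfl | rfl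
    · rfl
    · exact key _ _ rfl h6 i1 i2
    · exact (key _ _ rfl h6 i2 i1).symm
    · rfl
  rw [this]

theorem Reroute.not_mem {G : SimpleGraph W} {p q : List W × W} (h : Reroute G p q) :
    p.2 ∉ p.1 := by
  obtain ⟨l, j⟩ := p
  obtain ⟨l₁, m⟩ := q
  obtain ⟨pre, a, t, t₁, h1, h2, h3, h4, h5, h6, h7⟩ := h
  simp only at h1 h2 h3 h4 h5 ⊢
  subst h1 h2
  have := h4.nodup
  have h8 : ∀ x, x ∈ t₁ ↔ x ∈ t := by rcases h7 with rfl | rfl <;> simp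
  have h9 := h5.ne
  simp [List.nodup_append, h8] at this ⊢
  grind

/-- The neighbours are `a`, the replaced vertex, and one end of the tail. The value 3 separates
rerouting from extension, where the count is 1. -/
theorem Reroute.nbrCount {G : SimpleGraph W} {p q : List W × W} (h : Reroute G p q) :
    nbrCount G p.2 p.1 = 3 := by
  obtain ⟨l, j⟩ := p
  obtain ⟨l₁, m⟩ := q
  obtain ⟨pre, a, t, t₁, h1, h2, h3, h4, h5, h6, h7⟩ := h
  simp only at h1 h2 h3 h4 h5 ⊢
  subst h1 h2
  have h8 : FreeFermion.nbrCount G j t = FreeFermion.nbrCount G j t₁ := by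
    rcases h7 with rfl | rfl
    · rfl
    · rw [nbrCount_reverse]
  have h9 : FreeFermion.nbrCount G j t₁ = 1 :=
    h4.append_right.2.nbrCount_head (by rcases h7 with rfl | rfl <;> simpa)
  rw [nbrCount_append, nbrCount_eq_zero h4.not_adj_pre, nbrCount_cons, nbrCount_cons, h8, h9,
    if_pos h5, if_pos h4.adj_mid.symm]

theorem mem_closedNbhd {G : SimpleGraph W} {L : List W} {w : W} :
    w ∈ closedNbhd G L ↔ ∃ x ∈ L, w = x ∨ G.Adj x w := Iff.rfl

/-- Only the replaced vertex `m` leaves the path. A neighbour of `m` missed by the new path would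
form a claw at `m` with `a` and the first vertex of `t`, both of which remain. -/
theorem Reroute.closedNbhd_subset {G : SimpleGraph W} (hG : ClawFree G) {p q : List W × W}
    (h : Reroute G p q) : closedNbhd G p.1 ⊆ closedNbhd G q.1 := by
  obtain ⟨l, j⟩ := p
  obtain ⟨l₁, m⟩ := q
  obtain ⟨pre, a, t, t₁, h1, h2, h3, h4, h5, h6, h7⟩ := h
  simp only at h1 h2 h3 h4 h5 ⊢
  subst h1 h2
  have h8 : ∀ x, x ∈ t₁ ↔ x ∈ t := by rcases h7 with rfl | rfl <;> simp
  rintro v ⟨x, hx, hxv⟩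
  by_contra hv
  simp only [mem_closedNbhd, List.mem_append, List.mem_cons, not_exists, not_and, not_or, h8] at hv
  simp only [List.mem_append, List.mem_cons] at hx
  have hxm : x = m := by
    by_contra hne
    have := hv x (by tauto)
    tauto
  subst hxm
  have ha := hv a (by simp)
  obtain ⟨c, t, rfl⟩ := List.exists_cons_of_ne_nil h6
  have hc := hv c (by simp)
  have i := h3.append_right
  have hac := i.1 c (by simp)
  have nac : ¬ G.Adj a c := by
    rw [hac.2]
    simpa using (i.2.1 c (by simp)).1
  have hxc : G.Adj x c := (i.2.1 c (by simp)).2.2 rfl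
  have hav : v ≠ x := fun e => ha.2 (e ▸ h3.adj_mid)
  exact hc.2 (hG.adj_of_center h3.adj_mid.symm hxc (hxv.resolve_left hav) hac.1 (Ne.symm ha.1)
    (Ne.symm hc.1) nac ha.2)

theorem Reroute.closedNbhd_eq {G : SimpleGraph W} (hG : ClawFree G) {p q : List W × W}
    (h : Reroute G p q) : closedNbhd G p.1 = closedNbhd G q.1 :=
  (h.closedNbhd_subset hG).antisymm (h.symm.closedNbhd_subset hG)

end Combinatorics

/-! ### Vertices with an odd number of neighbours on a path; closing a path to a cycle. -/

section Classification

universe u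

variable {W : Type u}

theorem IndPath.claw_at_end {G : SimpleGraph W} (hG : ClawFree G) {l : List W} {p a x y : W}
    (h : IndPath G (l ++ [p, a])) (hx : G.Adj a x) (hy : G.Adj a y) (hxy : x ≠ y)
    (px : p ≠ x) (py : p ≠ y) (npx : ¬ G.Adj p x) (npy : ¬ G.Adj p y) : G.Adj x y :=
  hG.adj_of_center h.adj_mid.symm hx hy px py hxy npx npy

/-- A vertex with an odd number of neighbours on an induced path of a claw-free graph is the last
vertex of the path, or extends the path, or allows one to reroute the path. -/
theorem IndPath.classify {G : SimpleGraph W} (hG : ClawFree G) {L : List W} {j : W}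
    (hL : IndPath G L) (hhead : L.head? ≠ some j)
    (hroot : ∀ a m t, L = a :: m :: t → G.Adj j a → j ≠ m → G.Adj j m)
    (hodd : Odd (nbrCount G j L)) :
    (L.getLast? = some j) ∨ IndPath G (L ++ [j]) ∨ ∃ q, Reroute G (L, j) q := by
  by_cases hj : j ∈ L
  · left
    obtain ⟨l₁, l₂, rfl⟩ := List.append_of_mem hj
    have h1 : l₁ ≠ [] := by rintro rfl; simp at hhead
    rcases l₂ with _ | ⟨z, l₂⟩
    · simp
    · exfalso
      have h2 : IndPath G (l₁ ++ [j]) := by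
        rw [List.append_cons] at hL
        exact hL.append_left
      -- An interior vertex has one neighbour on each side, an even total.
      rw [nbrCount_append, nbrCount_cons, if_neg G.irrefl, h2.nbrCount_last h1,
        hL.append_right.nbrCount_head (by simp)] at hodd
      exact absurd hodd (by decide)
  right
  obtain ⟨pre, a, rest, rfl, hpre, haj⟩ := exists_first_nbr (G := G) (x := j) (l := L)
    (fun h => by simp [h] at hodd)
  rcases rest with _ | ⟨m, t⟩
  · left
    rw [indPath_concat]
    refine ⟨hL, fun y hy => ⟨fun h => hj (h ▸ hy), ?_⟩⟩
    simp only [List.mem_append, List.mem_singleton] at hy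
    rcases hy with hy | rfl
    · have := hpre y hy
      have h3 : y ≠ a := fun h => this (h ▸ haj)
      simp [G.adj_comm y, this, h3.symm]
    · simp [haj.symm]
  right
  have hjm : j ≠ m := fun h => hj (by simp [h])
  have ham := hL.adj_mid
  -- Otherwise `a` is the centre of a claw on `j`, `m` and its predecessor. If `a` has no
  -- predecessor, `hroot` takes over.
  have hadj : G.Adj j m := by
    rcases List.eq_nil_or_concat' pre with rfl | ⟨pre, p, rfl⟩
    · exact hroot a m t rfl haj hjm
    · have h1 : IndPath G ((pre ++ [p]) ++ a :: m :: t) := hL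
      have h2 := (indPath_append.1 h1).2.2 p (by simp) m (by simp)
      have h3 := (h1.append_right.1 m (by simp)).1
      have h4 := (indPath_append.1 h1).2.2 p (by simp) a (by simp)
      refine hG.adj_of_center (h4.2.2 (by simp)).symm haj.symm ham (fun h => hj (by simp [h]))
        h2.1 hjm (fun h => hpre p (by simp) h.symm) ?_
      rw [h2.2]
      simp [h3]
  rw [nbrCount_append, nbrCount_eq_zero hpre, nbrCount_cons, nbrCount_cons, if_pos hadj,
    if_pos haj] at hodd
  obtain ⟨t₁, e, t₂, rfl, ht₁, hje⟩ := exists_first_nbr (G := G) (x := j) (l := t)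
    (fun h => by rw [h] at hodd; exact absurd hodd (by decide))
  have ia : IndPath G (a :: m :: (t₁ ++ e :: t₂)) := hL.append_right
  -- The neighbour `e` must be an end of the tail. If a vertex `f` follows `e`, claws at `j` through
  -- `a` and `e` exclude neighbours beyond `f`, and parity then excludes `f`. A predecessor of `e`
  -- in the tail would now give a claw at `e` with `j` and `f`.
  have htail : ∃ t', (t' = t₁ ++ e :: t₂ ∨ t' = (t₁ ++ e :: t₂).reverse) ∧
      ∀ y ∈ t', (G.Adj j y ↔ t'.head? = some y) := by
    rcases t₂ with _ | ⟨f, t₃⟩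
    · refine ⟨_, Or.inr rfl, ?_⟩
      intro y hy
      simp only [List.reverse_append, List.reverse_cons, List.reverse_nil, List.nil_append,
        List.mem_append, List.mem_singleton, List.mem_reverse] at hy
      rcases hy with rfl | hy
      · simp [hje]
      · have h1 := ht₁ y hy
        have h2 : e ≠ y := fun h => h1 (h ▸ hje)
        simp [h1, h2]
    · have nadj : ∀ y ∈ t₁ ++ e :: f :: t₃, a ≠ y ∧ ¬ G.Adj a y := by
        intro y hy
        have h1 := ia.1 y (by simp at hy ⊢; tauto)
        refine ⟨h1.1, ?_⟩
        rw [h1.2]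
        have h2 := (ia.2.1 y hy).1
        simpa using h2
      have ie : IndPath G (e :: f :: t₃) := ia.2.2.append_right
      have ht₃ : ∀ g ∈ t₃, ¬ G.Adj j g := by
        intro g hg hjg
        have h1 := nadj e (by simp)
        have h2 := nadj g (by simp [hg])
        have h3 := ie.1 g (by simp [hg])
        have h4 := hG.adj_of_center haj hje hjg h1.1 h2.1 h3.1 h1.2 h2.2
        rw [h3.2] at h4
        simp at h4
        have := ie.2.nodup
        simp [h4, hg] at this
      have hf : ¬ G.Adj j f := by
        intro hf
        rw [nbrCount_append, nbrCount_eq_zero ht₁, nbrCount_cons, nbrCount_cons, if_pos hje,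
          if_pos hf, nbrCount_eq_zero ht₃] at hodd
        exact absurd hodd (by decide)
      have ht₁' : t₁ = [] := by
        rcases List.eq_nil_or_concat' t₁ with rfl | ⟨s, q, rfl⟩
        · rfl
        exfalso
        have h1 : IndPath G ((s ++ [q]) ++ e :: f :: t₃) := ia.2.2
        have h2 := (indPath_append.1 h1).2.2 q (by simp) f (by simp)
        have h3 := (h1.append_right.1 f (by simp)).1
        have h4 := (indPath_append.1 h1).2.2 q (by simp) e (by simp)
        refine hf (hG.adj_of_center (h4.2.2 (by simp)).symm hje.symm h1.adj_mid
          (fun h => hj (by simp [h])) h2.1 (fun h => hj (by simp [h]))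
          (fun h => ht₁ q (by simp) h.symm) ?_)
        rw [h2.2]
        simp [h3]
      subst ht₁'
      refine ⟨_, Or.inl rfl, ?_⟩
      intro y hy
      simp only [List.nil_append, List.mem_cons] at hy
      rcases hy with rfl | rfl | hy
      · simp [hje]
      · simp [hf, (ie.1 y (by simp)).1]
      · simp [ht₃ y hy, (ie.1 y (by simp [hy])).1]
  obtain ⟨t', ht', hhd⟩ := htail
  have hmem : ∀ y, y ∈ t' ↔ y ∈ t₁ ++ e :: t₂ := by
    intro y
    rcases ht' with rfl | rfl <;> simp; tauto
  refine ⟨(pre ++ a :: j :: t', m), pre, a, t₁ ++ e :: t₂, t', rfl, rfl, hL, ?_, hadj, by simp, ht'⟩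
  have hpa : IndPath G (pre ++ [a]) := by
    have : pre ++ a :: m :: (t₁ ++ e :: t₂) = (pre ++ [a]) ++ m :: (t₁ ++ e :: t₂) := by simp
    rw [this] at hL
    exact hL.append_left
  have e1 : ∀ s : List W, pre ++ a :: s = (pre ++ [a]) ++ s := by simp
  simp only
  rw [e1, indPath_append]
  refine ⟨hpa, ⟨?_, ?_⟩, ?_⟩
  · intro y hy
    refine ⟨fun h => hj ?_, hhd y hy⟩
    rw [hmem, ← h] at hy
    rw [e1]
    simp only [List.mem_append, List.mem_cons] at hy ⊢
    tauto
  · have := ia.2.2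
    rcases ht' with rfl | rfl
    · exact this
    · exact indPath_reverse.2 this
  · intro x hx y hy
    simp only [List.mem_cons] at hy
    rcases hy with rfl | hy
    · refine ⟨fun h => hj ?_, ?_⟩
      · rw [e1, ← h]; exact List.mem_append_left _ hx
      · simp only [List.mem_append, List.mem_singleton] at hx
        rcases hx with hx | rfl
        · have h1 := hpre x hx
          have h2 : a ≠ x := fun h => h1 (h ▸ haj)
          simp [G.adj_comm x, h1, h2]
        · simp [haj.symm]
    · have hy' := (hmem y).1 hy
      rw [e1, indPath_append] at hL
      have h1 := hL.2.2 x hx y (by simp at hy' ⊢; tauto)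
      have h2 : m ≠ y := (hL.2.1.1 y hy').1
      have h3 : j ≠ y := by
        rintro rfl
        apply hj
        rw [e1]
        simp only [List.mem_append, List.mem_cons] at hy' ⊢
        tauto
      refine ⟨h1.1, ?_⟩
      rw [h1.2]
      simp [h2, h3]

theorem cycleGraph_adj_iff {n : ℕ} {i j : Fin (n + 3)} :
    (SimpleGraph.cycleGraph (n + 3)).Adj i j ↔
      i.val + 1 = j.val ∨ j.val + 1 = i.val ∨ (i.val = 0 ∧ j.val = n + 2) ∨
        (j.val = 0 ∧ i.val = n + 2) := by
  rw [SimpleGraph.cycleGraph_adj']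
  have hi := i.isLt
  have hj := j.isLt
  rw [Fin.val_sub, Fin.val_sub]
  rcases lt_trichotomy i.val j.val with h | h | h
  · rw [Nat.mod_eq_of_lt (a := n + 3 - j.val + i.val) (by omega),
      Nat.mod_eq_sub_mod (a := n + 3 - i.val + j.val) (by omega), Nat.mod_eq_of_lt (by omega)]
    omega
  · rw [h]
    have : (n + 3 - j.val + j.val) % (n + 3) = 0 := by
      rw [Nat.sub_add_cancel hj.le, Nat.mod_self]
    omega
  · rw [Nat.mod_eq_of_lt (a := n + 3 - i.val + j.val) (by omega),
      Nat.mod_eq_sub_mod (a := n + 3 - j.val + i.val) (by omega), Nat.mod_eq_of_lt (by omega)]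
    omega

/-- Here `m` sees only the first vertex of `t` and `j` only the last, so the edge `jm` closes the
path to an induced cycle. -/
theorem exists_cycle_embedding {G : SimpleGraph W} {j m : W} {t : List W} (ht : t ≠ [])
    (hmt : IndPath G (m :: t)) (hjt : IndPath G (j :: t.reverse)) (hjm : G.Adj j m) :
    ∃ f : SimpleGraph.cycleGraph (t.length + 2) ↪g G, ∀ i, f i ∈ j :: m :: t := by
  obtain ⟨n, hn⟩ : ∃ n, t.length = n + 1 := Nat.exists_eq_succ_of_ne_zero (by simpa using ht)
  have hnd : (j :: m :: t).Nodup := by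
    have h1 := hmt.nodup
    have h2 := hjt.nodup
    have := hjm.ne
    simp at h1 h2 ⊢
    tauto
  have h0 : ∀ i : Fin (m :: t).length,
      G.Adj j ((m :: t).get i) ↔ (i.val = 0 ∨ i.val = n + 1) := by
    intro i
    refine Fin.cases ?_ (fun i => ?_) i
    · simp [hjm]
    · have h1 := (hjt.1 (t.get i) (by simp)).2
      rw [List.head?_reverse, List.getLast?_eq_getElem?,
        List.getElem?_eq_getElem (by have := i.isLt; omega), Option.some_inj, List.get_eq_getElem,
        hmt.2.nodup.getElem_inj_iff] at h1
      simp [h1]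
      omega
  have h1 := (indPath_iff.1 hmt).2
  have hadj : ∀ i i' : Fin (j :: m :: t).length,
      G.Adj ((j :: m :: t).get i) ((j :: m :: t).get i') ↔
        i.val + 1 = i'.val ∨ i'.val + 1 = i.val ∨ (i.val = 0 ∧ i'.val = n + 2) ∨
        (i'.val = 0 ∧ i.val = n + 2) := by
    intro i i'
    refine Fin.cases ?_ (fun i => ?_) i <;> refine Fin.cases ?_ (fun i' => ?_) i'
    · simp
    · have := h0 i'
      simp at this ⊢
      rw [this]
    · have := h0 i
      rw [SimpleGraph.adj_comm] at this
      simp at this ⊢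
      rw [this]
    · have := h1 i i'
      simp at this ⊢
      rw [this]
  refine ⟨⟨⟨fun i => (j :: m :: t).get i, List.nodup_iff_injective_get.1 hnd⟩, ?_⟩,
    fun i => List.get_mem _ _⟩
  intro i i'
  refine (hadj i i').trans ?_
  clear h0 h1 hadj hnd hmt hjt
  revert i i'
  simp only [List.length_cons]
  rw [hn]
  intro i i'
  exact cycleGraph_adj_iff.symm

end Classification

/-! ### Signs of products along induced paths. -/

section Signs

universe u v

variable {W : Type u} {A : Type v} [Ring A]

theorem mul_prod_eq {G : SimpleGraph W} {f : W → A}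
    (ha : ∀ x y, G.Adj x y → f x * f y = -(f y * f x))
    (hc : ∀ x y, ¬ G.Adj x y → f x * f y = f y * f x) (x : W) (L : List W) :
    f x * (L.map f).prod = (-1) ^ nbrCount G x L * ((L.map f).prod * f x) := by
  induction L with
  | nil => simp [nbrCount_nil]
  | cons y L ih =>
    have e : f x * (f y * (L.map f).prod) = f x * f y * (L.map f).prod := by noncomm_ring
    have c : f y * (-1 : A) ^ nbrCount G x L = (-1) ^ nbrCount G x L * f y :=
      ((Commute.neg_one_right _).pow_right _).eq
    rw [List.map_cons, List.prod_cons, nbrCount_cons, e]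
    by_cases h : G.Adj x y
    · rw [ha x y h, if_pos h, neg_mul, mul_assoc (f y), ih, ← mul_assoc, c, pow_succ]
      noncomm_ring
    · rw [hc x y h, if_neg h, mul_assoc (f y), ih, ← mul_assoc, c, add_zero]
      noncomm_ring

/-- Reversal interchanges every pair once, and only the `L.length - 1` consecutive pairs
anticommute. -/
theorem prod_reverse_eq {G : SimpleGraph W} {f : W → A}
    (ha : ∀ x y, G.Adj x y → f x * f y = -(f y * f x))
    (hc : ∀ x y, ¬ G.Adj x y → f x * f y = f y * f x) {L : List W} (hL : IndPath G L) :
    (L.reverse.map f).prod = (-1) ^ (L.length - 1) * (L.map f).prod := by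
  induction L with
  | nil => simp
  | cons x L ih =>
    have h := mul_prod_eq ha hc x L
    rw [List.reverse_cons, List.map_append, List.prod_append, ih hL.2, List.map_cons, List.map_nil,
      List.prod_singleton, List.map_cons, List.prod_cons, h]
    rcases eq_or_ne L [] with rfl | hne
    · simp [nbrCount_nil]
    · rw [hL.nbrCount_head hne]
      obtain ⟨y, L, rfl⟩ := List.exists_cons_of_ne_nil hne
      simp only [List.length_cons, Nat.add_sub_cancel]
      rw [pow_succ]
      noncomm_ring

/-- Moving the left factor past `pre ++ [a]` costs one sign in both products, leaving `f j * f m` in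
one and `f m * f j` in the other; these are opposite. The hypothesis `hhole` is used only to show
that reversing the tail costs no sign. -/
theorem Reroute.prod_add_prod {G : SimpleGraph W} {f : W → A}
    (ha : ∀ x y, G.Adj x y → f x * f y = -(f y * f x))
    (hc : ∀ x y, ¬ G.Adj x y → f x * f y = f y * f x) {p q : List W × W} (h : Reroute G p q)
    (hhole : ∀ n, 4 ≤ n → Even n → ∀ g : SimpleGraph.cycleGraph n ↪g G,
      ∃ i, p.1.head? = some (g i)) :
    f p.2 * (p.1.map f).prod + f q.2 * (q.1.map f).prod = 0 := by
  have hmem := h.not_mem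
  obtain ⟨l, j⟩ := p
  obtain ⟨l₁, m⟩ := q
  obtain ⟨pre, a, t, t', h1, h2, h3, h4, h5, h6, h7⟩ := h
  simp only at h1 h2 h3 h4 h5 hhole hmem ⊢
  subst h1 h2
  have e1 : ∀ s : List W, pre ++ a :: s = (pre ++ [a]) ++ s := by simp
  have hprod : (t'.map f).prod = (t.map f).prod := by
    rcases h7 with rfl | rfl
    · rfl
    rw [prod_reverse_eq ha hc h3.append_right.2.2]
    -- For even length, `j`, `m` and `t` form an even hole, which would have to contain the head of
    -- the path. But the head lies in `pre ++ [a]`.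
    rcases Nat.even_or_odd t.length with he | ho
    · exfalso
      obtain ⟨g, hg⟩ := exists_cycle_embedding h6 h3.append_right.2 h4.append_right.2 h5
      have : t.length ≠ 0 := by simpa using h6
      obtain ⟨i, hi⟩ := hhole _ (by obtain ⟨r, hr⟩ := he; omega) (Even.add he (by decide)) g
      have hgi := hg i
      generalize g i = w at hi hgi
      have hnd := h3.nodup
      rcases pre with _ | ⟨y, pre⟩ <;> simp at hi hgi hnd hmem <;> grind
    · rw [(Nat.Odd.sub_odd ho odd_one).neg_one_pow, one_mul]
  have s : ∀ x s, IndPath G (pre ++ a :: x :: s) →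
      f x * ((pre ++ [a]).map f).prod = -(((pre ++ [a]).map f).prod * f x) := by
    intro x s hx
    have : pre ++ a :: x :: s = ((pre ++ [a]) ++ [x]) ++ s := by simp
    rw [this] at hx
    rw [mul_prod_eq ha hc, hx.append_left.nbrCount_last (by simp)]
    simp
  rw [e1 (m :: t), e1 (j :: t'), List.map_append, List.map_append (l₂ := j :: t'), List.prod_append, List.prod_append,
    ← mul_assoc, ← mul_assoc, s j t' h4, s m t h3, List.map_cons, List.map_cons, List.prod_cons,
    List.prod_cons, hprod, neg_mul, neg_mul, mul_assoc, mul_assoc, ← mul_assoc (f j),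
    ← mul_assoc (f m), ha j m h5]
  noncomm_ring

end Signs

/-! ### Expansions of the independence polynomial. -/

section IndependenceRecursion

universe u

variable {V : Type u}

open Classical in
-- Independent sets are split by whether they contain `k`; those that do correspond to independent
-- sets avoiding the closed neighbourhood of `k`.
theorem indepPoly_erase (G : SimpleGraph V) (b : V → ℝ) {U : Finset V} {k : V} (hk : k ∈ U) :
    indepPoly G b U = indepPoly G b (U.erase k) -
      Polynomial.X * Polynomial.C ((b k : ℂ) ^ 2) *
        indepPoly G b (U.filter fun j => j ≠ k ∧ ¬ G.Adj k j) := by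
  unfold indepPoly
  rw [← Finset.sum_filter_add_sum_filter_not _ (fun S => k ∉ S), sub_eq_add_neg]
  congr 1
  · refine Finset.sum_congr ?_ fun _ _ => rfl
    ext S
    simp only [Finset.mem_filter, Finset.mem_powerset, Finset.subset_erase]
    tauto
  · rw [Finset.mul_sum, ← Finset.sum_neg_distrib]
    symm
    refine Finset.sum_bij' (fun S _ => insert k S) (fun S _ => S.erase k) ?_ ?_ ?_ ?_ ?_
    · intro S hS
      simp only [Finset.mem_filter, Finset.mem_powerset] at hS ⊢
      refine ⟨⟨Finset.insert_subset hk (hS.1.trans (Finset.filter_subset _ _)), ?_⟩, by simp⟩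
      rw [Finset.coe_insert, SimpleGraph.IsIndepSet, Set.pairwise_insert]
      refine ⟨hS.2, fun j hj _ => ?_⟩
      have h1 := (Finset.mem_filter.1 (hS.1 hj)).2.2
      exact ⟨h1, fun h => h1 h.symm⟩
    · intro S hS
      simp only [Finset.mem_filter, Finset.mem_powerset, not_not] at hS ⊢
      refine ⟨fun j hj => ?_, hS.1.2.mono (by simp)⟩
      rw [Finset.mem_erase] at hj
      exact Finset.mem_filter.2 ⟨hS.1.1 hj.2, hj.1, hS.1.2 hS.2 hj.2 hj.1.symm⟩
    · intro S hS
      refine Finset.erase_insert fun h => ?_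
      simp only [Finset.mem_filter, Finset.mem_powerset] at hS
      exact (Finset.mem_filter.1 (hS.1 h)).2.1 rfl
    · intro S hS
      simp only [Finset.mem_filter, not_not] at hS
      exact Finset.insert_erase hS.2
    · intro S hS
      have hkS : k ∉ S := fun h => by
        simp only [Finset.mem_filter, Finset.mem_powerset] at hS
        exact (Finset.mem_filter.1 (hS.1 h)).2.1 rfl
      rw [Finset.card_insert_of_notMem hkS, Finset.prod_insert hkS, pow_succ]
      ring

open Classical in
/-- Expansion of the independence polynomial along a clique. -/
theorem indepPoly_sdiff_clique (G : SimpleGraph V) (b : V → ℝ) {U : Finset V} (C : Finset V)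
    (hC : C ⊆ U) (hcl : G.IsClique (C : Set V)) :
    indepPoly G b U = indepPoly G b (U \ C) - Polynomial.X *
      ∑ k ∈ C, Polynomial.C ((b k : ℂ) ^ 2) *
        indepPoly G b (U.filter fun j => j ≠ k ∧ ¬ G.Adj k j) := by
  induction C using Finset.induction_on with
  | empty => simp
  | insert k C hk ih =>
    rw [Finset.insert_subset_iff] at hC
    rw [ih hC.2 (hcl.subset (by simp)), indepPoly_erase G b (U := U \ C) (k := k) (by simp [hC, hk]),
      Finset.sum_insert hk, ← Finset.sdiff_insert]
    -- The clique vertices removed earlier are neighbours of `k`, so their absence does not affect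
    -- this term.
    have : (U \ C).filter (fun j => j ≠ k ∧ ¬ G.Adj k j) =
        U.filter (fun j => j ≠ k ∧ ¬ G.Adj k j) := by
      ext j
      simp only [Finset.mem_filter, Finset.mem_sdiff]
      refine ⟨fun h => ⟨h.1.1, h.2⟩, fun h => ⟨⟨h.1, fun hj => h.2.2 ?_⟩, h.2⟩⟩
      exact hcl (by simp) (by simp [hj]) h.2.1.symm
    rw [this]
    ring

open Classical in
theorem indepPolySq_sdiff_clique (G : SimpleGraph V) (b : V → ℝ) {U : Finset V} (C : Finset V)
    (hC : C ⊆ U) (hcl : G.IsClique (C : Set V)) :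
    indepPolySq G b U = indepPolySq G b (U \ C) - Polynomial.X ^ 2 *
      ∑ k ∈ C, Polynomial.C ((b k : ℂ) ^ 2) *
        indepPolySq G b (U.filter fun j => j ≠ k ∧ ¬ G.Adj k j) := by
  unfold indepPolySq
  rw [indepPoly_sdiff_clique G b C hC hcl]
  simp [Polynomial.sub_comp, Polynomial.mul_comp, Polynomial.sum_comp]

end IndependenceRecursion

/-! ### Rooted paths in the extended graph and their residual polynomials. -/

section Extended

universe u v

variable {V : Type u} {G : SimpleGraph V} {K : Set V}

/-- A cycle avoiding the root already lies in `G`. This suffices, because the cycles met in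
rerouting miss the root. -/
theorem EvenHoleFree.exists_eq_none (hG : EvenHoleFree G) {n : ℕ} (hn : 4 ≤ n) (he : Even n)
    (g : SimpleGraph.cycleGraph n ↪g extendedGraph G K) : ∃ i, g i = none := by
  by_contra! h
  have h' : ∀ i, ∃ v, g i = some v := fun i => Option.ne_none_iff_exists'.1 (h i)
  choose f hf using h'
  refine hG n hn he ⟨⟨⟨f, fun i j hij => g.injective ?_⟩, ?_⟩⟩
  · rw [hf, hf, hij]
  · intro i j
    have := g.map_rel_iff (a := i) (b := j)
    rw [hf, hf] at this
    exact this

theorem IndPath.exists_some_of_cons {l : List (Option V)} {x : Option V}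
    (h : IndPath (extendedGraph G K) (none :: l)) (hx : x ∈ l) : ∃ j, x = some j :=
  Option.ne_none_iff_exists'.1 fun e => (h.1 x hx).1 e.symm

/-- Inside a rooted path, the vertex following the root lies in the clique. -/
theorem adj_second_of_adj_root (hK : G.IsClique K) {L : List (Option V)} {j : V}
    (hL : IndPath (extendedGraph G K) L) (hr : L.head? = some none) (a m : Option V)
    (t : List (Option V)) (e : L = a :: m :: t) (ha : (extendedGraph G K).Adj (some j) a)
    (hm : some j ≠ m) : (extendedGraph G K).Adj (some j) m := by
  subst e
  simp only [List.head?_cons, Option.some.injEq] at hr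
  subst hr
  obtain ⟨k, rfl⟩ := hL.exists_some_of_cons (x := m) (by simp)
  have h1 : k ∈ K := (hL.1 (some k) (by simp)).2.2 rfl
  exact hK (show j ∈ K from ha) h1 (fun h => hm (by rw [h]))

variable [Fintype V]

theorem mem_rootedPaths' {L : List (Option V)} :
    L ∈ rootedPaths (extendedGraph G K) none ↔
      IndPath (extendedGraph G K) L ∧ L.head? = some none := by
  rw [mem_rootedPaths, isInducedPath_iff]
  constructor
  · rintro ⟨⟨_, h⟩, h'⟩
    exact ⟨h, h'⟩
  · rintro ⟨h, h'⟩
    exact ⟨⟨by rintro rfl; simp at h', h⟩, h'⟩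

open Classical in
/-- The vertices by which the path can be extended to a longer induced path. -/
noncomputable def extensions (G : SimpleGraph V) (K : Set V) (L : List (Option V)) : Finset V :=
  {j | IndPath (extendedGraph G K) (L ++ [some j])}

theorem mem_extensions {L : List (Option V)} {j : V} :
    j ∈ extensions G K L ↔ IndPath (extendedGraph G K) (L ++ [some j]) := by
  simp [extensions]

/-- Deleting the last vertex is the inverse of extending. This reindexing lets shortening and
extending terms be collected on a common path. -/
theorem sum_rootedPaths {M : Type*} [AddCommMonoid M] (F : List (Option V) → M) :
    ∑ L ∈ rootedPaths (extendedGraph G K) none, F L =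
      F [none] + ∑ L ∈ rootedPaths (extendedGraph G K) none,
        ∑ j ∈ extensions G K L, F (L ++ [some j]) := by
  classical
  have h0 : [none] ∈ rootedPaths (extendedGraph G K) none := by
    simp [mem_rootedPaths', IndPath]
  rw [← Finset.add_sum_erase _ _ h0, Finset.sum_sigma']
  congr 1
  symm
  refine Finset.sum_bij (fun p _ => p.1 ++ [some p.2]) ?_ ?_ ?_ (fun _ _ => rfl)
  · rintro ⟨L, j⟩ h
    simp only [Finset.mem_sigma, mem_rootedPaths', mem_extensions] at h
    have hL : L ≠ [] := by rintro rfl; simp at h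
    rw [Finset.mem_erase, mem_rootedPaths']
    refine ⟨fun e => ?_, h.2, by rw [List.head?_append_of_ne_nil _ hL, h.1.2]⟩
    have := congrArg List.getLast? e
    simp at this
  · rintro ⟨L, j⟩ _ ⟨L', j'⟩ _ h
    have := List.append_inj' h rfl
    simp at this
    simp [this]
  · intro L h
    rw [Finset.mem_erase, mem_rootedPaths'] at h
    rcases List.eq_nil_or_concat' L with rfl | ⟨l, x, rfl⟩
    · simp at h
    have hl : l ≠ [] := by
      rintro rfl
      simp at h
      exact h.1 h.2.2
    have hr : l.head? = some none := by rw [← h.2.2, List.head?_append_of_ne_nil _ hl]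
    obtain ⟨y, l, rfl⟩ := List.exists_cons_of_ne_nil hl
    simp only [List.head?_cons, Option.some.injEq] at hr
    subst hr
    obtain ⟨j, rfl⟩ := IndPath.exists_some_of_cons (l := l ++ [x]) h.2.1 (x := x) (by simp)
    refine ⟨⟨none :: l, j⟩, ?_, rfl⟩
    simp only [Finset.mem_sigma, mem_rootedPaths', mem_extensions]
    exact ⟨⟨h.2.1.append_left, rfl⟩, h.2.1⟩

theorem mem_residual {L : List (Option V)} {j : V} :
    j ∈ residual G K L ↔ ∀ x ∈ L, some j ≠ x ∧ ¬ (extendedGraph G K).Adj x (some j) := by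
  simp [residual, mem_closedNbhd]

theorem mem_extensions_concat {l : List (Option V)} {x : Option V} {j : V}
    (hL : IndPath (extendedGraph G K) (l ++ [x])) :
    j ∈ extensions G K (l ++ [x]) ↔
      j ∈ residual G K l ∧ (extendedGraph G K).Adj x (some j) := by
  rw [mem_extensions, indPath_concat, mem_residual]
  have hx : ∀ y ∈ l, x ≠ y := fun y hy => ((indPath_concat.1 hL).2 y hy).1.symm
  constructor
  · rintro ⟨_, h⟩
    refine ⟨fun y hy => ?_, (h x (by simp)).2.2 (by simp)⟩
    have h1 := h y (by simp [hy])
    refine ⟨h1.1.symm, ?_⟩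
    rw [h1.2]
    simpa using hx y hy
  · rintro ⟨h1, h2⟩
    refine ⟨hL, fun y hy => ?_⟩
    simp only [List.mem_append, List.mem_singleton] at hy
    rcases hy with hy | rfl
    · refine ⟨(h1 y hy).1.symm, ?_⟩
      simpa [hx y hy] using (h1 y hy).2
    · exact ⟨h2.ne, by simpa using h2⟩

open Classical in
/-- The recursion of the residual independence polynomials along the rooted paths. -/
theorem indepPolySq_residual (hK : IsSimplicialClique G K) (b : V → ℝ) {L : List (Option V)}
    (hL : L ∈ rootedPaths (extendedGraph G K) none) :
    indepPolySq G b (residual G K L) = indepPolySq G b (residual G K L.dropLast) +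
      Polynomial.X ^ 2 * ∑ j ∈ extensions G K L, Polynomial.C ((b j : ℂ) ^ 2) *
        indepPolySq G b (residual G K (L ++ [some j])) := by
  rw [mem_rootedPaths'] at hL
  obtain ⟨hL, hr⟩ := hL
  rcases List.eq_nil_or_concat' L with rfl | ⟨l, x, rfl⟩
  · simp at hr
  have hsub : extensions G K (l ++ [x]) ⊆ residual G K l := fun j hj =>
    ((mem_extensions_concat hL).1 hj).1
  -- Two nonadjacent extensions would form a claw at the endpoint with its predecessor; at the root
  -- they lie in `K`.
  have hcl : G.IsClique (extensions G K (l ++ [x]) : Set V) := by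
    intro j hj k hk hjk
    have hj' := (mem_extensions_concat hL).1 hj
    have hk' := (mem_extensions_concat hL).1 hk
    rcases List.eq_nil_or_concat' l with rfl | ⟨l, p, rfl⟩
    · simp only [List.nil_append, List.head?_cons, Option.some.injEq] at hr
      subst hr
      exact hK.isClique (show j ∈ K from hj'.2) (show k ∈ K from hk'.2) hjk
    · have h1 := mem_residual.1 hj'.1 p (by simp)
      have h2 := mem_residual.1 hk'.1 p (by simp)
      exact IndPath.claw_at_end hK.clawFree_extended (x := some j) (y := some k) (by simpa using hL)
        hj'.2 hk'.2 (by simpa using hjk) h1.1.symm h2.1.symm h1.2 h2.2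
  have hx : ∀ j ∈ residual G K l, some j ≠ x := by
    rintro j hj rfl
    rcases List.eq_nil_or_concat' l with rfl | ⟨l, p, rfl⟩
    · simp at hr
    · have h1 := mem_residual.1 hj p (by simp)
      exact h1.2 (((indPath_concat.1 hL).2 p (by simp)).2.2 (by simp))
  have hdiff : residual G K l \ extensions G K (l ++ [x]) = residual G K (l ++ [x]) := by
    ext j
    rw [Finset.mem_sdiff, mem_extensions_concat hL, mem_residual (L := l ++ [x])]
    constructor
    · rintro ⟨h1, h2⟩ y hy
      simp only [List.mem_append, List.mem_singleton] at hy
      rcases hy with hy | rfl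
      · exact mem_residual.1 h1 y hy
      · exact ⟨hx j h1, fun h => h2 ⟨h1, h⟩⟩
    · intro h
      exact ⟨mem_residual.2 fun y hy => h y (by simp [hy]), fun h' => (h x (by simp)).2 h'.2⟩
  -- The extensions form a clique, so deleting the closed neighbourhood of `k` also deletes every
  -- remaining neighbour of `x`.
  have hres : ∀ k ∈ extensions G K (l ++ [x]),
      (residual G K l).filter (fun j => j ≠ k ∧ ¬ G.Adj k j) =
        residual G K (l ++ [x] ++ [some k]) := by
    intro k hk
    ext j
    rw [Finset.mem_filter, mem_residual (L := l ++ [x] ++ [some k])]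
    constructor
    · rintro ⟨h1, h2, h3⟩ y hy
      have hj : j ∉ extensions G K (l ++ [x]) := fun hj => h3 (hcl hk hj h2.symm)
      have h4 : j ∈ residual G K (l ++ [x]) := by
        rw [← hdiff]
        exact Finset.mem_sdiff.2 ⟨h1, hj⟩
      rw [List.mem_append, List.mem_singleton] at hy
      rcases hy with hy | rfl
      · exact mem_residual.1 h4 y hy
      · exact ⟨by simpa using h2, h3⟩
    · intro h
      have h1 := h (some k) (by simp)
      exact ⟨mem_residual.2 fun y hy => h y (by simp [hy]), by simpa using h1.1, h1.2⟩
  rw [List.dropLast_concat, indepPolySq_sdiff_clique G b _ hsub hcl, hdiff,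
    Finset.sum_congr rfl fun k hk => by rw [hres k hk]]
  ring

end Extended

/-! ### Operator identities in a realization of the Clifford algebra. -/

section Realization

universe u v

variable {V : Type u} {A : Type v} [Ring A] [Algebra ℂ A] (G : SimpleGraph V) (K : Set V)
  (b : V → ℝ) (ρ : GraphClifford (extendedGraph G K) →ₐ[ℂ] A)

theorem cliffordGen_mul_self {W : Type u} (G : SimpleGraph W) (x : W) :
    cliffordGen G x * cliffordGen G x = 1 := by
  have := RingQuot.mkAlgHom_rel ℂ (CliffordRel.sq (G := G) x)
  simpa [cliffordGen] using this

theorem cliffordGen_anticomm {W : Type u} {G : SimpleGraph W} {x y : W} (h : G.Adj x y) :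
    cliffordGen G x * cliffordGen G y = -(cliffordGen G y * cliffordGen G x) := by
  have := RingQuot.mkAlgHom_rel ℂ (CliffordRel.anticomm (G := G) x y h)
  simpa [cliffordGen] using this

theorem cliffordGen_comm {W : Type u} {G : SimpleGraph W} {x y : W} (h : ¬ G.Adj x y) :
    cliffordGen G x * cliffordGen G y = cliffordGen G y * cliffordGen G x := by
  have := RingQuot.mkAlgHom_rel ℂ (CliffordRel.comm (G := G) x y h)
  simpa [cliffordGen] using this

theorem vertexOp_eq_smul (x : Option V) :
    vertexOp G K b ρ x = (x.elim (1 : ℂ) fun j => (b j : ℂ)) •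
      ρ (cliffordGen (extendedGraph G K) x) := by
  cases x <;> simp [vertexOp]

theorem vertexOp_anticomm (x y : Option V) (h : (extendedGraph G K).Adj x y) :
    vertexOp G K b ρ x * vertexOp G K b ρ y = -(vertexOp G K b ρ y * vertexOp G K b ρ x) := by
  simp only [vertexOp_eq_smul, smul_mul_smul_comm, ← map_mul, cliffordGen_anticomm h, map_neg,
    smul_neg]
  rw [mul_comm]

theorem vertexOp_comm (x y : Option V) (h : ¬ (extendedGraph G K).Adj x y) :
    vertexOp G K b ρ x * vertexOp G K b ρ y = vertexOp G K b ρ y * vertexOp G K b ρ x := by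
  simp only [vertexOp_eq_smul, smul_mul_smul_comm, ← map_mul, cliffordGen_comm h]
  rw [mul_comm]

theorem vertexOp_mul_self (j : V) :
    vertexOp G K b ρ (some j) * vertexOp G K b ρ (some j) = ((b j : ℂ) ^ 2) • (1 : A) := by
  simp only [vertexOp_eq_smul, smul_mul_smul_comm, ← map_mul, cliffordGen_mul_self, map_one,
    Option.elim_some, sq]

theorem vertexOp_mul_pathProd (x : Option V) (L : List (Option V)) :
    vertexOp G K b ρ x * pathProd G K b ρ L =
      (-1) ^ nbrCount (extendedGraph G K) x L * (pathProd G K b ρ L * vertexOp G K b ρ x) :=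
  mul_prod_eq (vertexOp_anticomm G K b ρ) (vertexOp_comm G K b ρ) x L

open Classical in
-- The two factors commute or anticommute by parity; the factor one half absorbs the 2 of the
-- anticommuting case.
theorem half_commutator_pathProd (x : Option V) (L : List (Option V)) :
    (1 / 2 : ℂ) • (vertexOp G K b ρ x * pathProd G K b ρ L -
        pathProd G K b ρ L * vertexOp G K b ρ x) =
      if Odd (nbrCount (extendedGraph G K) x L) then vertexOp G K b ρ x * pathProd G K b ρ L
      else 0 := by
  have h := vertexOp_mul_pathProd G K b ρ x L
  split_ifs with ho
  · rw [ho.neg_one_pow, neg_one_mul] at h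
    rw [eq_neg_iff_add_eq_zero, add_comm, ← eq_neg_iff_add_eq_zero] at h
    rw [h, sub_neg_eq_add, ← two_smul ℂ, smul_smul]
    norm_num
  · rw [(Nat.not_odd_iff_even.1 ho).neg_one_pow, one_mul] at h
    rw [h, sub_self, smul_zero]

theorem pathProd_concat (x : Option V) (L : List (Option V)) :
    pathProd G K b ρ (L ++ [x]) = pathProd G K b ρ L * vertexOp G K b ρ x := by
  simp [pathProd]

theorem vertexOp_mul_pathProd_of_extends {x : Option V} {L : List (Option V)} (hL : L ≠ [])
    (h : IndPath (extendedGraph G K) (L ++ [x])) :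
    vertexOp G K b ρ x * pathProd G K b ρ L = -pathProd G K b ρ (L ++ [x]) := by
  rw [vertexOp_mul_pathProd, h.nbrCount_last hL, pathProd_concat]
  simp

theorem vertexOp_mul_pathProd_concat {j : V} {L : List (Option V)} (hL : L ≠ [])
    (h : IndPath (extendedGraph G K) (L ++ [some j])) :
    vertexOp G K b ρ (some j) * pathProd G K b ρ (L ++ [some j]) =
      -(((b j : ℂ) ^ 2) • pathProd G K b ρ L) := by
  rw [pathProd_concat, ← mul_assoc, vertexOp_mul_pathProd_of_extends G K b ρ hL h, pathProd_concat,
    neg_mul, mul_assoc, vertexOp_mul_self, mul_smul_comm, mul_one]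

end Realization

/-! ### Power series with a scalar part and an operator coefficient. -/

section Series

universe v

variable {A : Type v} [Ring A] [Algebra ℂ A]

/-- The power series `p a` with scalar part `p` and coefficient `a`. -/
noncomputable def scalarMul : PowerSeries ℂ →ₗ[ℂ] A →ₗ[ℂ] PowerSeries A :=
  LinearMap.mk₂ ℂ (fun p a => PowerSeries.mk fun n => PowerSeries.coeff n p • a)
    (fun p q a => by ext n; simp [add_smul])
    (fun c p a => by ext n; simp [mul_smul])
    (fun p a a' => by ext n; simp)
    (fun c p a => by ext n; simp [smul_comm c])

@[simp]
theorem coeff_scalarMul (n : ℕ) (p : PowerSeries ℂ) (a : A) :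
    PowerSeries.coeff n (scalarMul p a) = PowerSeries.coeff n p • a := by
  simp [scalarMul]

theorem scalarMul_eq (p : PowerSeries ℂ) (a : A) :
    scalarMul p a = PowerSeries.map (algebraMap ℂ A) p * PowerSeries.C a := by
  ext n
  simp [Algebra.smul_def]

end Series

/-! ### Pairwise cancellation of the rerouting terms. -/

section Cancellation

universe u v

variable {V : Type u} [Fintype V] {G : SimpleGraph V} {K : Set V}

/-- The path can be rerouted through the vertex. -/
def Reroutable (G : SimpleGraph V) (K : Set V) (p : List (Option V) × V) : Prop :=
  ∃ q, Reroute (extendedGraph G K) (p.1, some p.2) q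

/-- The replaced vertex comes after `a`, so it is never the root and the new path keeps its first
vertex. -/
theorem Reroutable.exists_rootedPath {p : List (Option V) × V} (h : Reroutable G K p)
    (hp : p.1 ∈ rootedPaths (extendedGraph G K) none) :
    ∃ q : List (Option V) × V, q.1 ∈ rootedPaths (extendedGraph G K) none ∧
      Reroute (extendedGraph G K) (p.1, some p.2) (q.1, some q.2) := by
  obtain ⟨⟨l, m⟩, h⟩ := h
  obtain ⟨L, j⟩ := p
  have h' := h
  obtain ⟨pre, a, t, t', h1, h2, h3, h4, h5, h6, h7⟩ := h'
  simp only at h1 h2 h3 h4 hp h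
  rw [mem_rootedPaths'] at hp
  have hm : m ≠ none := by
    rintro rfl
    have h8 := h3.nodup
    have h9 := hp.2
    rw [h1] at h8 h9
    rcases pre with _ | ⟨y, pre⟩ <;> simp at h8 h9 <;> simp_all
  obtain ⟨k, rfl⟩ := Option.ne_none_iff_exists'.1 hm
  refine ⟨(l, k), ?_, h⟩
  rw [mem_rootedPaths']
  refine ⟨h4, ?_⟩
  rw [← hp.2, h1, h2]
  rcases pre with _ | ⟨y, pre⟩ <;> simp

theorem Reroute.length_eq {W : Type u} {G : SimpleGraph W} {p q : List W × W}
    (h : Reroute G p q) : p.1.length = q.1.length := by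
  obtain ⟨pre, a, t, t', h1, h2, h3, h4, h5, h6, h7⟩ := h
  rw [h1, h2]
  rcases h7 with rfl | rfl <;> simp

theorem Reroute.residual_eq (hK : IsSimplicialClique G K) {p q : List (Option V) × Option V}
    (h : Reroute (extendedGraph G K) p q) : residual G K p.1 = residual G K q.1 := by
  unfold residual
  rw [h.closedNbhd_eq hK.clawFree_extended]

variable {A : Type v} [Ring A] [Algebra ℂ A]

open Classical in
-- Rerouting is a sign-reversing involution, by symmetry and uniqueness of the partner. The weight
-- `w` may be arbitrary because it sees only the length and the residual set, both invariant.
theorem sum_reroutable_eq_zero (hG : EvenHoleFree G) (hK : IsSimplicialClique G K) (b : V → ℝ)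
    (ρ : GraphClifford (extendedGraph G K) →ₐ[ℂ] A) (w : ℕ → Finset V → PowerSeries ℂ) :
    ∑ L ∈ rootedPaths (extendedGraph G K) none, ∑ j : V,
      (if Reroutable G K (L, j) then
        scalarMul (w L.length (residual G K L))
          (vertexOp G K b ρ (some j) * pathProd G K b ρ L) else 0) = 0 := by
  rw [← Finset.sum_product', ← Finset.sum_filter]
  have hmem : ∀ p ∈ (rootedPaths (extendedGraph G K) none ×ˢ (Finset.univ : Finset V)).filter
      (fun p => Reroutable G K (p.1, p.2)), ∃ q : List (Option V) × V,
        q.1 ∈ rootedPaths (extendedGraph G K) none ∧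
        Reroute (extendedGraph G K) (p.1, some p.2) (q.1, some q.2) := by
    intro p hp
    simp only [Finset.mem_filter, Finset.mem_product, Finset.mem_univ, and_true] at hp
    exact Reroutable.exists_rootedPath hp.2 hp.1
  choose g hg1 hg2 using hmem
  refine Finset.sum_involution g ?_ ?_ ?_ ?_
  · intro p hp
    have h := hg2 p hp
    have hp' : p.1 ∈ rootedPaths (extendedGraph G K) none := by
      simp only [Finset.mem_filter, Finset.mem_product] at hp
      exact hp.1.1
    rw [← h.length_eq, ← h.residual_eq hK, ← map_add]
    have := h.prod_add_prod (vertexOp_anticomm G K b ρ) (vertexOp_comm G K b ρ) (by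
      intro n hn he f
      obtain ⟨i, hi⟩ := hG.exists_eq_none hn he f
      exact ⟨i, by rw [hi]; exact (mem_rootedPaths'.1 hp').2⟩)
    unfold pathProd
    simp only at this
    rw [this, map_zero]
  · intro p hp _ he
    have h := hg2 p hp
    -- A fixed point would make the inserted vertex adjacent to itself.
    rw [he] at h
    obtain ⟨_, _, _, _, _, _, _, _, h, _⟩ := h
    exact (extendedGraph G K).irrefl h
  · intro p hp
    simp only [Finset.mem_filter, Finset.mem_product, Finset.mem_univ, and_true]
    exact ⟨hg1 p hp, _, (hg2 p hp).symm⟩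
  · intro p hp
    have h := (hg2 p hp).symm.unique (hg2 (g p hp) (by
      simp only [Finset.mem_filter, Finset.mem_product, Finset.mem_univ, and_true]
      exact ⟨hg1 p hp, _, (hg2 p hp).symm⟩))
    simp only [Prod.mk.injEq, Option.some.injEq] at h
    exact (Prod.ext h.1 h.2).symm

open Classical in
-- The three cases of the classification are disjoint: only an endpoint lies on `L`, and the
-- neighbour counts 1 and 3 separate the other two. All counts are odd, so no even term enters.
theorem half_commutator_hamiltonian (hK : IsSimplicialClique G K) (b : V → ℝ)
    (ρ : GraphClifford (extendedGraph G K) →ₐ[ℂ] A) {L : List (Option V)}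
    (hL : L ∈ rootedPaths (extendedGraph G K) none) :
    (1 / 2 : ℂ) • (hamiltonian G K b ρ * pathProd G K b ρ L -
        pathProd G K b ρ L * hamiltonian G K b ρ) =
      (∑ j ∈ extensions G K L, vertexOp G K b ρ (some j) * pathProd G K b ρ L) +
      (∑ j : V, if L.getLast? = some (some j) then
        vertexOp G K b ρ (some j) * pathProd G K b ρ L else 0) +
      ∑ j : V, if Reroutable G K (L, j) then
        vertexOp G K b ρ (some j) * pathProd G K b ρ L else 0 := by
  rw [hamiltonian, Finset.sum_mul, Finset.mul_sum, ← Finset.sum_sub_distrib, Finset.smul_sum,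
    extensions, Finset.sum_filter, ← Finset.sum_add_distrib, ← Finset.sum_add_distrib]
  refine Finset.sum_congr rfl fun j _ => ?_
  rw [half_commutator_pathProd]
  rw [mem_rootedPaths'] at hL
  obtain ⟨hL, hr⟩ := hL
  have hne : L ≠ [] := by rintro rfl; simp at hr
  have hB : IndPath (extendedGraph G K) (L ++ [some j]) →
      nbrCount (extendedGraph G K) (some j) L = 1 := fun h => h.nbrCount_last hne
  have hBm : IndPath (extendedGraph G K) (L ++ [some j]) → some j ∉ L := fun h hj =>
    ((indPath_concat.1 h).2 _ hj).1 rfl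
  have hC : Reroutable G K (L, j) → nbrCount (extendedGraph G K) (some j) L = 3 :=
    fun ⟨_, h⟩ => h.nbrCount
  have hCm : Reroutable G K (L, j) → some j ∉ L := fun ⟨_, h⟩ => h.not_mem
  have hAm : L.getLast? = some (some j) → some j ∈ L := List.mem_of_getLast?
  have hA : L.getLast? = some (some j) → nbrCount (extendedGraph G K) (some j) L = 1 := by
    intro h
    obtain ⟨l, rfl⟩ := List.getLast?_eq_some_iff.1 h
    have hl : l ≠ [] := by rintro rfl; simp at hr
    rw [nbrCount_append, hL.nbrCount_last hl, nbrCount_cons, if_neg (SimpleGraph.irrefl _),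
      nbrCount_nil]
  by_cases ho : Odd (nbrCount (extendedGraph G K) (some j) L)
  · have := hL.classify hK.clawFree_extended (by rw [hr]; simp)
      (adj_second_of_adj_root hK.isClique hL hr) ho
    rw [if_pos ho]
    rcases this with h | h | h
    · rw [if_neg fun h' => hBm h' (hAm h), if_pos h, if_neg fun h' => hCm h' (hAm h)]
      simp
    · rw [if_pos h, if_neg fun h' => hBm h (hAm h'),
        if_neg fun h' => by have := hB h; have := hC h'; omega]
      simp
    · have h : Reroutable G K (L, j) := h
      rw [if_neg fun h' => by have := hB h'; have := hC h; omega,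
        if_neg fun h' => hCm h (hAm h'), if_pos h]
      simp
  · rw [if_neg ho, if_neg fun h => ho (by rw [hB h]; decide),
      if_neg fun h => ho (by rw [hA h]; decide), if_neg fun h => ho (by rw [hC h]; decide)]
    simp

end Cancellation

/-! ### The fixed-point equation and its solution. -/

section Recursion

universe u v

variable {V : Type u} [Fintype V] {G : SimpleGraph V} {K : Set V}
  {A : Type v} [Ring A] [Algebra ℂ A]

/-- The scalar coefficient of a path of given length and residual vertex set, up to the common
factor `P_G(u ^ 2)⁻¹`. -/
noncomputable def pathCoeff (G : SimpleGraph V) (b : V → ℝ) (n : ℕ) (U : Finset V) :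
    PowerSeries ℂ :=
  (-PowerSeries.X) ^ (n - 1) * (indepPolySq G b U : PowerSeries ℂ)

/-- The recursion satisfied by the generalized path-product operator, multiplied by an arbitrary
scalar series `r`. -/
theorem sum_scalarMul_pathProd (hG : EvenHoleFree G) (hK : IsSimplicialClique G K) (b : V → ℝ)
    (ρ : GraphClifford (extendedGraph G K) →ₐ[ℂ] A) (r : PowerSeries ℂ) :
    ∑ L ∈ rootedPaths (extendedGraph G K) none,
        scalarMul (pathCoeff G b L.length (residual G K L) * r) (pathProd G K b ρ L) =
      scalarMul ((indepPolySq G b Finset.univ : PowerSeries ℂ) * r) (vertexOp G K b ρ none) +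
      ∑ L ∈ rootedPaths (extendedGraph G K) none,
        scalarMul (PowerSeries.X * (pathCoeff G b L.length (residual G K L) * r))
          ((1 / 2 : ℂ) • (hamiltonian G K b ρ * pathProd G K b ρ L -
            pathProd G K b ρ L * hamiltonian G K b ρ)) := by
  classical
  set w : ℕ → Finset V → PowerSeries ℂ := fun n U => PowerSeries.X * (pathCoeff G b n U * r) with hw
  have hne : ∀ L ∈ rootedPaths (extendedGraph G K) none, L ≠ [] := by
    rintro _ h rfl
    simp [mem_rootedPaths'] at h
  -- Shortening `L ++ [some j]` yields `-b_j²` times the product along `L`; the sign and one power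
  -- of `-u` combine with the prefactor `u` to `u²`.
  have hlast : ∑ L ∈ rootedPaths (extendedGraph G K) none, scalarMul (w L.length (residual G K L))
      (∑ j : V, if L.getLast? = some (some j) then
        vertexOp G K b ρ (some j) * pathProd G K b ρ L else 0) =
      ∑ L ∈ rootedPaths (extendedGraph G K) none,
        scalarMul ((-PowerSeries.X) ^ (L.length - 1) * (PowerSeries.X ^ 2 *
          ∑ j ∈ extensions G K L, PowerSeries.C ((b j : ℂ) ^ 2) *
            (indepPolySq G b (residual G K (L ++ [some j])) : PowerSeries ℂ)) * r)
          (pathProd G K b ρ L) := by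
    rw [sum_rootedPaths]
    simp only [List.getLast?_singleton, Option.some.injEq, reduceCtorEq, if_false,
      Finset.sum_const_zero, map_zero, zero_add]
    refine Finset.sum_congr rfl fun L hL => ?_
    rw [Finset.mul_sum, Finset.mul_sum, Finset.sum_mul, map_sum, LinearMap.sum_apply]
    refine Finset.sum_congr rfl fun j hj => ?_
    simp only [List.getLast?_concat, Option.some.injEq]
    rw [Finset.sum_ite_eq, if_pos (Finset.mem_univ _),
      vertexOp_mul_pathProd_concat G K b ρ (hne L hL) (mem_extensions.1 hj), map_neg, map_smul,
      ← LinearMap.smul_apply, ← map_smul, ← LinearMap.neg_apply, ← map_neg]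
    congr 2
    obtain ⟨n, hn⟩ := Nat.exists_eq_succ_of_ne_zero (mt List.length_eq_zero_iff.1 (hne L hL))
    rw [hw, PowerSeries.smul_eq_C_mul]
    simp only [pathCoeff, List.length_append, List.length_singleton, hn, Nat.add_sub_cancel,
      Nat.succ_eq_add_one, pow_succ]
    ring
  -- The coefficient of each extended path comes from its `dropLast`. The path `[none]` is no
  -- extension; its would-be term, with residual set all of `V`, is subtracted and later cancels the
  -- `χ` term.
  have hext : ∑ L ∈ rootedPaths (extendedGraph G K) none, scalarMul (w L.length (residual G K L))
      (∑ j ∈ extensions G K L, vertexOp G K b ρ (some j) * pathProd G K b ρ L) =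
      (∑ L ∈ rootedPaths (extendedGraph G K) none,
        scalarMul ((-PowerSeries.X) ^ (L.length - 1) *
          (indepPolySq G b (residual G K L.dropLast) : PowerSeries ℂ) * r) (pathProd G K b ρ L)) -
        scalarMul ((indepPolySq G b Finset.univ : PowerSeries ℂ) * r) (vertexOp G K b ρ none) := by
    have hnil : residual G K [] = Finset.univ := by
      ext j
      simp [mem_residual]
    rw [sum_rootedPaths (fun L => scalarMul ((-PowerSeries.X) ^ (L.length - 1) *
          (indepPolySq G b (residual G K L.dropLast) : PowerSeries ℂ) * r) (pathProd G K b ρ L))]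
    simp only [List.length_singleton, Nat.sub_self, pow_zero, one_mul, List.dropLast_singleton,
      hnil, pathProd, List.map_singleton, List.prod_singleton, add_sub_cancel_left]
    refine Finset.sum_congr rfl fun L hL => ?_
    rw [map_sum]
    refine Finset.sum_congr rfl fun j hj => ?_
    have h := vertexOp_mul_pathProd_of_extends G K b ρ (hne L hL) (mem_extensions.1 hj)
    unfold pathProd at h
    rw [h, map_neg, ← LinearMap.neg_apply, ← map_neg, List.dropLast_concat]
    congr 2
    obtain ⟨n, hn⟩ := Nat.exists_eq_succ_of_ne_zero (mt List.length_eq_zero_iff.1 (hne L hL))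
    simp only [hw, pathCoeff, List.length_append, List.length_singleton, hn, Nat.add_sub_cancel,
      Nat.succ_eq_add_one, pow_succ]
    ring
  have hbad : ∑ L ∈ rootedPaths (extendedGraph G K) none, scalarMul (w L.length (residual G K L))
      (∑ j : V, if Reroutable G K (L, j) then
        vertexOp G K b ρ (some j) * pathProd G K b ρ L else 0) = 0 := by
    rw [← sum_reroutable_eq_zero hG hK b ρ w]
    refine Finset.sum_congr rfl fun L _ => ?_
    rw [map_sum]
    refine Finset.sum_congr rfl fun j _ => ?_
    split_ifs <;> simp
  have hsum : ∑ L ∈ rootedPaths (extendedGraph G K) none,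
      scalarMul (w L.length (residual G K L))
          ((1 / 2 : ℂ) • (hamiltonian G K b ρ * pathProd G K b ρ L -
            pathProd G K b ρ L * hamiltonian G K b ρ)) = _ :=
    Finset.sum_congr rfl fun L hL => by
      rw [half_commutator_hamiltonian hK b ρ hL, map_add, map_add]
  rw [hsum, Finset.sum_add_distrib, Finset.sum_add_distrib, hext, hlast, hbad, add_zero,
    ← add_assoc, add_sub_cancel, ← Finset.sum_add_distrib]
  refine Finset.sum_congr rfl fun L hL => ?_
  rw [← LinearMap.add_apply, ← map_add]
  congr 2
  have h := congrArg (fun p : Polynomial ℂ => (p : PowerSeries ℂ)) (indepPolySq_residual hK b hL)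
  simp only [Polynomial.coe_add, Polynomial.coe_mul, Polynomial.coe_pow, Polynomial.coe_X] at h
  have hs : ((∑ j ∈ extensions G K L, Polynomial.C ((b j : ℂ) ^ 2) *
      indepPolySq G b (residual G K (L ++ [some j])) : Polynomial ℂ) : PowerSeries ℂ) =
      ∑ j ∈ extensions G K L, PowerSeries.C ((b j : ℂ) ^ 2) *
        (indepPolySq G b (residual G K (L ++ [some j])) : PowerSeries ℂ) := by
    rw [← Polynomial.coeToPowerSeries.ringHom_apply, map_sum]
    simp [Polynomial.coeToPowerSeries.ringHom_apply]
  rw [hs] at h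
  rw [pathCoeff, h]
  ring

/-- Taking `r` to be the inverse of `P_G(u²)` turns the inhomogeneous term into `χ`. The factor `u`
then makes each coefficient half the commutator of `H` with the preceding one, which is the Krylov
recursion. -/
theorem krylovSeries_eq_sum (hG : EvenHoleFree G) (hK : IsSimplicialClique G K) (b : V → ℝ)
    (ρ : GraphClifford (extendedGraph G K) →ₐ[ℂ] A) :
    krylovSeries G K b ρ = ∑ L ∈ rootedPaths (extendedGraph G K) none,
      scalarMul (pathCoeff G b L.length (residual G K L) *
        (indepPolySq G b Finset.univ : PowerSeries ℂ)⁻¹) (pathProd G K b ρ L) := by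
  have h := sum_scalarMul_pathProd hG hK b ρ (indepPolySq G b Finset.univ : PowerSeries ℂ)⁻¹
  rw [PowerSeries.mul_inv_cancel _ (by rw [constantCoeff_indepPolySq]; exact one_ne_zero)] at h
  ext n
  rw [krylovSeries, PowerSeries.coeff_mk]
  induction n with
  | zero =>
    rw [h]
    simp only [krylov, map_add, map_sum, coeff_scalarMul, PowerSeries.coeff_zero_X_mul, zero_smul,
      Finset.sum_const_zero, add_zero, PowerSeries.coeff_zero_one, one_smul]
  | succ n ih =>
    rw [h]
    simp only [krylov, ih, map_add, map_sum, coeff_scalarMul, PowerSeries.coeff_succ_X_mul,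
      PowerSeries.coeff_one, Nat.succ_ne_zero, if_false, zero_smul, zero_add, Finset.mul_sum,
      Finset.sum_mul, ← Finset.sum_sub_distrib, Finset.smul_sum, mul_smul_comm, smul_mul_assoc]
    refine Finset.sum_congr rfl fun L _ => ?_
    rw [← smul_sub, smul_comm]

theorem coe_pathProductOperator (b : V → ℝ) (ρ : GraphClifford (extendedGraph G K) →ₐ[ℂ] A) :
    (pathProductOperator G K b ρ : PowerSeries A) =
      ∑ L ∈ rootedPaths (extendedGraph G K) none,
        scalarMul (pathCoeff G b L.length (residual G K L)) (pathProd G K b ρ L) := by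
  ext n
  rw [Polynomial.coeff_coe, pathProductOperator, Polynomial.finsetSum_coeff, map_sum]
  refine Finset.sum_congr rfl fun L _ => ?_
  have h1 : pathCoeff G b L.length (residual G K L) =
      (((-Polynomial.X) ^ (L.length - 1) * indepPolySq G b (residual G K L) : Polynomial ℂ) :
        PowerSeries ℂ) := by
    simp [pathCoeff]
  have h2 : (-Polynomial.X : Polynomial A) ^ (L.length - 1) *
      (indepPolySq G b (residual G K L)).map (algebraMap ℂ A) =
      ((-Polynomial.X) ^ (L.length - 1) * indepPolySq G b (residual G K L)).map
        (algebraMap ℂ A) := by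
    simp
  rw [h1, h2, coeff_scalarMul, Polynomial.coeff_coe, Polynomial.coeff_mul_C, Polynomial.coeff_map,
    Algebra.smul_def]

end Recursion

end FreeFermion

theorem mainTheorem2 {V : Type*} [Fintype V] (G : SimpleGraph V) (hconn : G.Connected)
    (hECF : FreeFermion.IsECF G) (K : Set V) (hK : FreeFermion.IsSimplicialClique G K)
    (b : V → ℝ) (hb : ∀ j, b j ≠ 0) {A : Type*} [Ring A] [Algebra ℂ A]
    (ρ : FreeFermion.GraphClifford (FreeFermion.extendedGraph G K) →ₐ[ℂ] A) :
    FreeFermion.krylovSeries G K b ρ =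
        PowerSeries.map (algebraMap ℂ A)
            ((FreeFermion.indepPolySq G b Finset.univ : PowerSeries ℂ)⁻¹) *
          (FreeFermion.pathProductOperator G K b ρ : PowerSeries A) ∧
      FreeFermion.krylovSeries G K b ρ =
        ∑ L ∈ FreeFermion.rootedPaths (FreeFermion.extendedGraph G K) none,
          (-PowerSeries.X) ^ (L.length - 1) *
            PowerSeries.map (algebraMap ℂ A)
              ((FreeFermion.indepPolySq G b (FreeFermion.residual G K L) : PowerSeries ℂ) *
                (FreeFermion.indepPolySq G b Finset.univ : PowerSeries ℂ)⁻¹) *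
            PowerSeries.C (FreeFermion.pathProd G K b ρ L) := by
  rw [FreeFermion.krylovSeries_eq_sum hECF.evenHoleFree hK b ρ]
  constructor
  · rw [FreeFermion.coe_pathProductOperator, Finset.mul_sum]
    refine Finset.sum_congr rfl fun L _ => ?_
    rw [FreeFermion.scalarMul_eq, FreeFermion.scalarMul_eq, ← mul_assoc, ← map_mul, mul_comm]
  · refine Finset.sum_congr rfl fun L _ => ?_
    rw [FreeFermion.scalarMul_eq, FreeFermion.pathCoeff, mul_assoc, map_mul]
    simp
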